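/- Let $\ell,\rho,c>0$ and let $A:[0,\ell]\to(0,\infty)$ be absolutely continuous with $A'\in L^2(0,\ell)$. Consider the lossless Webster horn model $$\psi_{tt}=\frac{c^2}{A(x)}\,\partial_x\bigl(A(x)\,\partial_x\psi\bigr)\ \ (0<x<\ell,\ t>0),\qquad -A(0)\psi_x(0,t)=i_0(t),\qquad \psi(\ell,t)=0,$$ with input $i_0$ and output $p_0(t)=\rho\psi_t(0,t)$ (the Dirichlet condition at $x=\ell$ being the zero termination $Z_L(s)=0$). With the state $(w_1,w_2)=(\psi,\rho\psi_t)$ in the complex Hilbert space $\mathcal X=H^1_{\{\ell\}}(0,\ell)\times L^2(0,\ell)$, write it as the triple $\Xi=(G,L,K)$ of operators on $\mathcal Z=H^2_{\{\ell\}}(0,\ell)\times H^1_{\{\ell\}}(0,\ell)$, $$G(w_1,w_2)=-A(0)w_1'(0),\qquad L(w_1,w_2)=\Bigl(\rho^{-1}w_2,\ \rho c^2\,\tfrac1A(Aw_1')'\Bigr),\qquad K(w_1,w_2)=w_2(0),$$ where the subscript $\{\ell\}$ means that functions vanish at $x=\ell$. Let $\mathcal A=L|_{\ker G}$, let $\mathcal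 A_{-1}:\mathcal X\to\mathcal X_{-1}$ be its extension to the extrapolation space $\mathcal X_{-1}$ (the completion of $\mathcal X$ in the norm $\|(\beta-\mathcal A)^{-1}x\|$, $\beta\in\rho(\mathcal A)$), let $B:\mathbb C\to\mathcal X_{-1}$ be given by $BG=L-\mathcal A_{-1}$ on $\mathcal Z$, and let the impedance of the horn be the transfer function $$Z_{ac}(s)=K(s-\mathcal A_{-1})^{-1}B\,1,\qquad s\in\rho(\mathcal A).$$ **Theorem.** $\Xi$ is a boundary node (that is, $(G,L,K)$ is closed as an operator from $\mathcal X$ to $\mathbb C\times\mathcal X\times\mathbb C$, $G$ is onto, $\ker G$ is dense in $\mathcal X$, and $\rho(\mathcal A)\neq\emptyset$), $0\in\rho(\mathcal A)$, and $$Z_{ac}(0)=0,\qquad Z_{ac}'(0)=C_{iner}:=\rho\int_0^\ell\frac{dx}{A(x)}.$$ Hence the zero termination is inertially feasible, that is, $\lim_{s\to0}Z_{ac}(s)/(C_{iner}s)$ exists (for complex $s\neq 0$) and is real; its value, the inertial factor, is $r_{iner}=1$. In other words, the acoustic inertance equals the flow-mechanical inertance $C_{iner}$. -/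

import Mathlib

open MeasureTheory Set Filter Topology

noncomputable section

/-! ### Boundary nodes and their transfer functions -/

/-- A colligation `Ξ = (G, L, K)` on `(U, X, Y)`: three linear operators with a common domain
`dom ⊆ X`, the input `G : dom → U`, the interior operator `L : dom → X` and the output
`K : dom → Y`. -/
structure Colligation (U X Y : Type*) [NormedAddCommGroup U] [NormedSpace ℂ U]
    [NormedAddCommGroup X] [NormedSpace ℂ X] [NormedAddCommGroup Y] [NormedSpace ℂ Y] where
  dom : Submodule ℂ X
  G : dom →ₗ[ℂ] U
  L : dom →ₗ[ℂ] X
  K : dom →ₗ[ℂ] Y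

namespace Colligation

variable {U X Y : Type*} [NormedAddCommGroup U] [NormedSpace ℂ U]
  [NormedAddCommGroup X] [NormedSpace ℂ X] [NormedAddCommGroup Y] [NormedSpace ℂ Y]

/-- `R` is the (bounded, everywhere defined) inverse of `s - A`, where `A = L|ker G`. -/
structure IsResolvent (Ξ : Colligation U X Y) (s : ℂ) (R : X →L[ℂ] X) : Prop where
  right_inv : ∀ x : X, ∃ h : R x ∈ Ξ.dom, Ξ.G ⟨R x, h⟩ = 0 ∧ s • R x - Ξ.L ⟨R x, h⟩ = x
  left_inv : ∀ z : Ξ.dom, Ξ.G z = 0 → R (s • (z : X) - Ξ.L z) = z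

/-- The resolvent set `ρ(A)` of the main operator `A = L|ker G`. -/
def resolventSet (Ξ : Colligation U X Y) : Set ℂ := {s | ∃ R, Ξ.IsResolvent s R}

/-- The resolvent `(s - A)⁻¹` for `s ∈ ρ(A)` (and `0` off the resolvent set). -/
def resolvent (Ξ : Colligation U X Y) (s : ℂ) : X →L[ℂ] X := by
  classical exact if h : s ∈ Ξ.resolventSet then h.choose else 0

/-- `Ξ` is a boundary node: `[G; L; K]` is closed as an operator from `X` to `U × X × Y`,
`G` is onto and `ker G` is dense in `X`, and `A = L|ker G` has nonempty resolvent set. -/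
structure IsBoundaryNode (Ξ : Colligation U X Y) : Prop where
  isClosed_graph : IsClosed {p : X × U × X × Y |
    ∃ z : Ξ.dom, p = ((z : X), Ξ.G z, Ξ.L z, Ξ.K z)}
  surjective_G : Function.Surjective Ξ.G
  dense_ker : Dense {x : X | ∃ h : x ∈ Ξ.dom, Ξ.G ⟨x, h⟩ = 0}
  resolventSet_nonempty : Ξ.resolventSet.Nonempty

/-- A fixed point `β` of the resolvent set of `A`. -/
def base (Ξ : Colligation U X Y) : ℂ := Classical.epsilon fun β => β ∈ Ξ.resolventSet

/-! The extrapolation space `X₋₁` is the completion of `X` in the norm `‖(β - A)⁻¹ x‖`.  The map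
`(β - A)⁻¹` is an isometry from `X` with that norm onto `dom A`, which is dense in `X`; so the
completion is realised as the space `X` itself, with `(β - A)⁻¹` as the embedding of `X`. -/

/-- The embedding `X → X₋₁`. -/
def embed (Ξ : Colligation U X Y) : X →L[ℂ] X := Ξ.resolvent Ξ.base

/-- The extension `A₋₁ : X → X₋₁` of `A` by continuity; in this realisation of `X₋₁` the operator
`β - A₋₁` is the identity. -/
def extGen (Ξ : Colligation U X Y) : X →L[ℂ] X := Ξ.base • Ξ.embed - ContinuousLinearMap.id ℂ X

/-- The control operator `B : U → X₋₁`, determined by `A₋₁ = L - B G` on `dom Ξ`: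
`B u = L z - A₋₁ z` for any `z` with `G z = u` (the value does not depend on `z`). -/
def control (Ξ : Colligation U X Y) (u : U) : X := by
  classical exact
    if h : ∃ z : Ξ.dom, Ξ.G z = u then Ξ.embed (Ξ.L h.choose) - Ξ.extGen (h.choose : X) else 0

/-- The observation/feedthrough operator `C&D = [K 0]` on the domain
`{(x, u) : x ∈ dom Ξ, G x = u}` of the system node (extended by `0`). -/
def obs (Ξ : Colligation U X Y) (p : X × U) : Y := by
  classical exact
    if h : ∃ hx : p.1 ∈ Ξ.dom, Ξ.G ⟨p.1, hx⟩ = p.2 then Ξ.K ⟨p.1, h.choose⟩ else 0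

/-- The operator `(s - A₋₁)⁻¹ : X₋₁ → X` for `s ∈ ρ(A)`. -/
def extResolvent (Ξ : Colligation U X Y) (s : ℂ) : X →L[ℂ] X :=
  Ring.inverse (s • Ξ.embed - Ξ.extGen)

/-- The transfer function of the system node of `Ξ`:
`𝐆(s) u = C&D [(s - A₋₁)⁻¹ B u; u]` for `s ∈ ρ(A)`. -/
def transferFunction (Ξ : Colligation U X Y) (s : ℂ) (u : U) : Y :=
  Ξ.obs (Ξ.extResolvent s (Ξ.control u), u)

end Colligation

/-! ### Sobolev spaces on `(0, ℓ)` -/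

namespace Webster

/-- The complex space `L²(0,ℓ)`. -/
abbrev L2 (ℓ : ℝ) : Type := Lp ℂ 2 (volume.restrict (Ioo 0 ℓ))

/-- `u` is the absolutely continuous representative on `[0,ℓ]` of `f ∈ L²(0,ℓ)`, and
`g ∈ L²(0,ℓ)` is its derivative. -/
structure IsACRep {ℓ : ℝ} (f g : L2 ℓ) (u : ℝ → ℂ) : Prop where
  ae_eq : f =ᵐ[volume.restrict (Ioo 0 ℓ)] u
  eq_integral : ∀ x ∈ Icc 0 ℓ, u x = u 0 + ∫ t in 0..x, g t

theorem integrableOn {ℓ : ℝ} (g : L2 ℓ) : IntegrableOn g (Ioc 0 ℓ) := by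
  have h : IntegrableOn g (Ioo 0 ℓ) volume := (Lp.memLp g).integrable (by norm_num)
  exact h.congr_set_ae Ioo_ae_eq_Ioc.symm

theorem intervalIntegrable_ofReal {h : ℝ → ℝ} {a b : ℝ} (hh : IntervalIntegrable h volume a b) :
    IntervalIntegrable (fun t => (h t : ℂ)) volume a b :=
  ⟨Integrable.ofReal hh.1, Integrable.ofReal hh.2⟩

theorem intervalIntegrable {ℓ x : ℝ} (g : L2 ℓ) (hx : x ∈ Icc 0 ℓ) :
    IntervalIntegrable g volume 0 x := by
  rw [intervalIntegrable_iff_integrableOn_Ioc_of_le hx.1]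
  exact (integrableOn g).mono_set (Ioc_subset_Ioc_right hx.2)

theorem intervalIntegral_congr {ℓ x : ℝ} {g h : ℝ → ℂ}
    (hgh : g =ᵐ[volume.restrict (Ioo 0 ℓ)] h) (hx : x ∈ Icc 0 ℓ) :
    ∫ t in 0..x, g t = ∫ t in 0..x, h t := by
  rw [intervalIntegral.integral_of_le hx.1, intervalIntegral.integral_of_le hx.1,
    integral_Ioc_eq_integral_Ioo, integral_Ioc_eq_integral_Ioo]
  exact integral_congr_ae (ae_restrict_of_ae_restrict_of_subset (Ioo_subset_Ioo_right hx.2) hgh)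

theorem IsACRep.zero {ℓ : ℝ} : IsACRep (0 : L2 ℓ) 0 0 where
  ae_eq := Lp.coeFn_zero _ _ _
  eq_integral x hx := by
    rw [intervalIntegral_congr (Lp.coeFn_zero _ _ _) hx]; simp

theorem IsACRep.add {ℓ : ℝ} {f g f' g' : L2 ℓ} {u u' : ℝ → ℂ} (h : IsACRep f g u)
    (h' : IsACRep f' g' u') : IsACRep (f + f') (g + g') (u + u') where
  ae_eq := (Lp.coeFn_add f f').trans (h.ae_eq.add h'.ae_eq)
  eq_integral x hx := by
    rw [intervalIntegral_congr (Lp.coeFn_add g g') hx]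
    simp only [Pi.add_apply]
    rw [intervalIntegral.integral_add (intervalIntegrable g hx) (intervalIntegrable g' hx),
      h.eq_integral x hx, h'.eq_integral x hx]
    ring

theorem IsACRep.smul {ℓ : ℝ} {f g : L2 ℓ} {u : ℝ → ℂ} (c : ℂ) (h : IsACRep f g u) :
    IsACRep (c • f) (c • g) (c • u) where
  ae_eq := (Lp.coeFn_smul c f).trans (h.ae_eq.const_smul c)
  eq_integral x hx := by
    rw [intervalIntegral_congr (Lp.coeFn_smul c g) hx]
    simp only [Pi.smul_apply]
    rw [intervalIntegral.integral_smul, h.eq_integral x hx, smul_add]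

theorem IsACRep.continuousOn {ℓ : ℝ} {f g : L2 ℓ} {u : ℝ → ℂ} (h : IsACRep f g u) :
    ContinuousOn u (Icc 0 ℓ) := by
  have h1 : ContinuousOn (fun x => u 0 + ∫ t in 0..x, g t) (Icc 0 ℓ) := by
    refine continuousOn_const.add ?_
    have hi : IntegrableOn g (Icc 0 ℓ) volume := (integrableOn g).congr_set_ae Ioc_ae_eq_Icc.symm
    rcases le_or_gt 0 ℓ with hℓ | hℓ
    · have := intervalIntegral.continuousOn_primitive_interval (a := 0) (b := ℓ) (μ := volume)
        (f := g) (by rwa [uIcc_of_le hℓ])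
      rwa [uIcc_of_le hℓ] at this
    · simp [Icc_eq_empty hℓ.not_ge]
  exact h1.congr h.eq_integral

/-- The representative of the zero function vanishes on `[0,ℓ]`. -/
theorem IsACRep.eqOn_zero {ℓ : ℝ} (hℓ : 0 < ℓ) {g : L2 ℓ} {u : ℝ → ℂ} (h : IsACRep 0 g u) :
    ∀ x ∈ Icc 0 ℓ, u x = 0 := by
  have h0 : u =ᵐ[volume.restrict (Ioo 0 ℓ)] fun _ => 0 :=
    h.ae_eq.symm.trans (Lp.coeFn_zero _ _ _)
  have h1 : EqOn u (fun _ => 0) (Ioo 0 ℓ) :=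
    Measure.eqOn_open_of_ae_eq h0 isOpen_Ioo (h.continuousOn.mono Ioo_subset_Icc_self)
      continuousOn_const
  have h2 : EqOn u (fun _ => 0) (Icc 0 ℓ) :=
    h1.of_subset_closure h.continuousOn continuousOn_const Ioo_subset_Icc_self
      (by rw [closure_Ioo hℓ.ne])
  exact h2

theorem IsACRep.deriv_zero {ℓ : ℝ} (hℓ : 0 < ℓ) {g : L2 ℓ} {u : ℝ → ℂ} (h : IsACRep 0 g u) :
    g = 0 := by
  have h0 := h.eqOn_zero hℓ
  have hI : ∀ x ∈ Icc 0 ℓ, ∫ t in 0..x, g t = 0 := fun x hx => by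
    have := h.eq_integral x hx
    rw [h0 x hx, h0 0 ⟨le_rfl, hℓ.le⟩] at this
    simpa using this.symm
  have hd := (intervalIntegrable g ⟨hℓ.le, le_rfl⟩).ae_hasDerivAt_integral
  refine (Lp.ext ?_ : g = 0)
  refine EventuallyEq.trans ?_ (Lp.coeFn_zero _ _ _).symm
  rw [EventuallyEq, ae_restrict_iff' measurableSet_Ioo]
  filter_upwards [hd] with x hx hxm
  have hxI : x ∈ uIcc 0 ℓ := by rw [uIcc_of_le hℓ.le]; exact Ioo_subset_Icc_self hxm
  have h1 := hx hxI 0 left_mem_uIcc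
  have h2 : HasDerivAt (fun x => ∫ t in 0..x, g t) 0 x := by
    refine (hasDerivAt_const x (0 : ℂ)).congr_of_eventuallyEq ?_
    filter_upwards [Ioo_mem_nhds hxm.1 hxm.2] with y hy
    exact hI y (Ioo_subset_Icc_self hy)
  exact h1.unique h2

/-- The Sobolev space `H¹(0,ℓ)`, as a subspace of `L²(0,ℓ)`: the functions with an absolutely
continuous representative whose derivative is in `L²(0,ℓ)`. -/
def H1 (ℓ : ℝ) : Submodule ℂ (L2 ℓ) where
  carrier := {f | ∃ g u, IsACRep f g u}
  zero_mem' := ⟨0, 0, IsACRep.zero⟩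
  add_mem' := by
    rintro f f' ⟨g, u, h⟩ ⟨g', u', h'⟩
    exact ⟨_, _, h.add h'⟩
  smul_mem' := by
    rintro c f ⟨g, u, h⟩
    exact ⟨_, _, h.smul c⟩

theorem IsACRep.unique {ℓ : ℝ} (hℓ : 0 < ℓ) {f g g' : L2 ℓ} {u u' : ℝ → ℂ} (h : IsACRep f g u)
    (h' : IsACRep f g' u') : g = g' ∧ ∀ x ∈ Icc 0 ℓ, u x = u' x := by
  have h1 := h.add (h'.smul (-1))
  rw [neg_one_smul, neg_one_smul, neg_one_smul, add_neg_cancel] at h1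
  refine ⟨?_, fun x hx => ?_⟩
  · have := h1.deriv_zero hℓ
    rwa [add_neg_eq_zero] at this
  · have := h1.eqOn_zero hℓ x hx
    simpa [add_neg_eq_zero] using this

theorem H1.exists_rep {ℓ : ℝ} (f : H1 ℓ) : ∃ p : L2 ℓ × (ℝ → ℂ), IsACRep (f : L2 ℓ) p.1 p.2 := by
  obtain ⟨f, g, u, h⟩ := f
  exact ⟨(g, u), h⟩

/-- The derivative `f' ∈ L²(0,ℓ)` of `f ∈ H¹(0,ℓ)`. -/
def H1.derivFun {ℓ : ℝ} (f : H1 ℓ) : L2 ℓ := (H1.exists_rep f).choose.1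

/-- The continuous representative of `f ∈ H¹(0,ℓ)`. -/
def H1.rep {ℓ : ℝ} (f : H1 ℓ) : ℝ → ℂ := (H1.exists_rep f).choose.2

theorem H1.isACRep {ℓ : ℝ} (f : H1 ℓ) : IsACRep (f : L2 ℓ) (H1.derivFun f) (H1.rep f) :=
  (H1.exists_rep f).choose_spec

/-- Differentiation `H¹(0,ℓ) → L²(0,ℓ)` as a linear map. -/
def H1.deriv {ℓ : ℝ} (hℓ : 0 < ℓ) : H1 ℓ →ₗ[ℂ] L2 ℓ where
  toFun := H1.derivFun
  map_add' f f' := ((H1.isACRep (f + f')).unique hℓ ((H1.isACRep f).add (H1.isACRep f'))).1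
  map_smul' c f := ((H1.isACRep (c • f)).unique hℓ ((H1.isACRep f).smul c)).1

/-- The point value `f ↦ f(x)` on `H¹(0,ℓ)`, `x ∈ [0,ℓ]`, as a linear map. -/
def H1.eval {ℓ : ℝ} (hℓ : 0 < ℓ) (x : ℝ) (hx : x ∈ Icc 0 ℓ) : H1 ℓ →ₗ[ℂ] ℂ where
  toFun f := H1.rep f x
  map_add' f f' := ((H1.isACRep (f + f')).unique hℓ ((H1.isACRep f).add (H1.isACRep f'))).2 x hx
  map_smul' c f := ((H1.isACRep (c • f)).unique hℓ ((H1.isACRep f).smul c)).2 x hx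

/-- The Hilbert space `H¹_{ℓ}(0,ℓ)` of the `f ∈ H¹(0,ℓ)` with `f(ℓ) = 0`, with the norm
`(‖f‖² + ‖f'‖²)^{1/2}`: it consists of the pairs `(f, f')`. -/
def H1D (ℓ : ℝ) : Submodule ℂ (WithLp 2 (L2 ℓ × L2 ℓ)) where
  carrier := {p | ∃ u, IsACRep p.fst p.snd u ∧ u ℓ = 0}
  zero_mem' := ⟨0, IsACRep.zero, rfl⟩
  add_mem' := by
    rintro p p' ⟨u, h, h0⟩ ⟨u', h', h0'⟩
    exact ⟨_, h.add h', by simp [h0, h0']⟩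
  smul_mem' := by
    rintro c p ⟨u, h, h0⟩
    exact ⟨_, h.smul c, by simp [h0]⟩

/-- `x ↦ ∫₀ˣ g` depends continuously on `g ∈ L²(0,ℓ)`. -/
theorem continuous_primitive {ℓ x : ℝ} (hx : x ∈ Icc 0 ℓ) :
    Continuous fun g : L2 ℓ => ∫ t in 0..x, g t := by
  have h : ∀ g : L2 ℓ, ∫ t in 0..x, g t = inner ℂ
      (indicatorConstLp 2 (measurableSet_Ioo (a := (0 : ℝ)) (b := x))
        (measure_ne_top (volume.restrict (Ioo 0 ℓ)) _) (1 : ℂ)) g := by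
    intro g
    rw [L2.inner_indicatorConstLp_one, Measure.restrict_restrict measurableSet_Ioo,
      inter_eq_left.mpr (Ioo_subset_Ioo_right hx.2), intervalIntegral.integral_of_le hx.1,
      integral_Ioc_eq_integral_Ioo]
  simp_rw [h]
  exact continuous_const.inner continuous_id

theorem isClosed_H1D {ℓ : ℝ} (hℓ : 0 < ℓ) :
    IsClosed (H1D ℓ : Set (WithLp 2 (L2 ℓ × L2 ℓ))) := by
  refine IsSeqClosed.isClosed fun p q hp hpq => ?_
  have hf : Tendsto (fun n => (p n).fst) atTop (𝓝 q.fst) :=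
    ((WithLp.prod_continuous_ofLp 2 _ _).fst.tendsto q).comp hpq
  have hg : Tendsto (fun n => (p n).snd) atTop (𝓝 q.snd) :=
    ((WithLp.prod_continuous_ofLp 2 _ _).snd.tendsto q).comp hpq
  choose u hu hu0 using hp
  obtain ⟨ns, hns, hae⟩ := (tendstoInMeasure_of_tendsto_Lp hf).exists_seq_tendsto_ae
  refine ⟨fun x => -(∫ t in 0..ℓ, q.snd t) + ∫ t in 0..x, q.snd t, ⟨?_, fun x hx => ?_⟩, ?_⟩
  · have hall : ∀ᵐ x ∂(volume.restrict (Ioo 0 ℓ)), ∀ n, (p n).fst x = u n x :=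
      ae_all_iff.mpr fun n => (hu n).ae_eq
    filter_upwards [hae, hall, ae_restrict_mem measurableSet_Ioo] with x h1 h2 hx
    have hx' : x ∈ Icc 0 ℓ := Ioo_subset_Icc_self hx
    refine tendsto_nhds_unique h1 ?_
    have h3 : ∀ n, (p n).fst x = -(∫ t in 0..ℓ, (p n).snd t) + ∫ t in 0..x, (p n).snd t := by
      intro n
      have e := (hu n).eq_integral ℓ ⟨hℓ.le, le_rfl⟩
      rw [hu0 n] at e
      rw [h2 n, (hu n).eq_integral x hx', eq_neg_of_add_eq_zero_left e.symm]
    simp_rw [h3]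
    exact ((((continuous_primitive ⟨hℓ.le, le_rfl⟩).tendsto _).comp hg).neg.add
      (((continuous_primitive hx').tendsto _).comp hg)).comp hns.tendsto_atTop
  · simp
  · simp

/-! ### Webster's horn model -/

/-- The data of a lossless horn: length `ℓ`, density `ρ`, speed of sound `c`, and a positive area
function `A` in `H¹(0,ℓ)`, i.e. absolutely continuous on `[0,ℓ]` with derivative in `L²(0,ℓ)`. -/
structure Horn where
  ℓ : ℝ
  ρ : ℝ
  c : ℝ
  A : ℝ → ℝ
  ℓ_pos : 0 < ℓ
  ρ_pos : 0 < ρ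
  c_pos : 0 < c
  A_pos : ∀ x ∈ Icc 0 ℓ, 0 < A x
  A_ac : AbsolutelyContinuousOnInterval A 0 ℓ
  A_deriv : MemLp (deriv A) 2 (volume.restrict (Ioo 0 ℓ))

namespace Horn

variable (W : Horn)

theorem zero_mem : (0 : ℝ) ∈ Icc 0 W.ℓ := ⟨le_rfl, W.ℓ_pos.le⟩

theorem ℓ_mem : W.ℓ ∈ Icc 0 W.ℓ := ⟨W.ℓ_pos.le, le_rfl⟩

theorem continuousOn_A : ContinuousOn W.A (Icc 0 W.ℓ) := by
  have := W.A_ac.continuousOn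
  rwa [uIcc_of_le W.ℓ_pos.le] at this

end Horn

theorem memLp_mul {ℓ : ℝ} {m : ℝ → ℂ} (hm : ContinuousOn m (Icc 0 ℓ)) {f : ℝ → ℂ}
    (hf : MemLp f 2 (volume.restrict (Ioo 0 ℓ))) :
    MemLp (fun x => m x * f x) 2 (volume.restrict (Ioo 0 ℓ)) := by
  obtain ⟨C, hC⟩ := isCompact_Icc.exists_bound_of_continuousOn hm
  have h1 : MemLp m ⊤ (volume.restrict (Ioo 0 ℓ)) := by
    refine memLp_top_of_bound ((hm.mono Ioo_subset_Icc_self).aestronglyMeasurable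
      measurableSet_Ioo) C ?_
    rw [ae_restrict_iff' measurableSet_Ioo]
    exact Eventually.of_forall fun x hx => hC x (Ioo_subset_Icc_self hx)
  exact hf.mul' h1

/-- Multiplication by a continuous function on `L²(0,ℓ)`. -/
def mulOp {ℓ : ℝ} (m : ℝ → ℂ) (hm : ContinuousOn m (Icc 0 ℓ)) : L2 ℓ →ₗ[ℂ] L2 ℓ where
  toFun f := (memLp_mul hm (Lp.memLp f)).toLp _
  map_add' f g := by
    rw [← MemLp.toLp_add]
    refine MemLp.toLp_congr _ _ ?_
    filter_upwards [Lp.coeFn_add f g] with x hx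
    change m x * (f + g : L2 ℓ) x = m x * f x + m x * g x
    rw [hx, Pi.add_apply, mul_add]
  map_smul' c f := by
    rw [RingHom.id_apply, ← MemLp.toLp_const_smul]
    refine MemLp.toLp_congr _ _ ?_
    filter_upwards [Lp.coeFn_smul c f] with x hx
    change m x * (c • f : L2 ℓ) x = c • (m x * f x)
    rw [hx, Pi.smul_apply, smul_eq_mul, smul_eq_mul, mul_left_comm]

/-- The product rule, real-valued. -/
theorem mul_primitive {A : ℝ → ℝ} {x : ℝ} (hA : AbsolutelyContinuousOnInterval A 0 x)
    {h : ℝ → ℝ} (hh : IntervalIntegrable h volume 0 x) :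
    A x * ∫ t in 0..x, h t = ∫ t in 0..x, (deriv A t * (∫ r in 0..t, h r) + A t * h t) := by
  have hv := hh.absolutelyContinuousOnInterval_intervalIntegral (c := 0) (by simp)
  have := hA.integral_deriv_mul_eq_sub hv
  simp only [intervalIntegral.integral_same, mul_zero, sub_zero] at this
  rw [← this]
  refine intervalIntegral.integral_congr_ae ?_
  filter_upwards [hh.ae_hasDerivAt_integral] with t ht hmem
  rw [(ht (uIoc_subset_uIcc hmem) 0 (by simp)).deriv]

/-- The product rule, complex-valued. -/
theorem mul_primitive_complex {A : ℝ → ℝ} {x : ℝ} (hA : AbsolutelyContinuousOnInterval A 0 x)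
    {g : ℝ → ℂ} (hg : IntervalIntegrable g volume 0 x) :
    (A x : ℂ) * ∫ t in 0..x, g t
      = ∫ t in 0..x, (((deriv A t : ℝ) : ℂ) * (∫ r in 0..t, g r) + (A t : ℂ) * g t) := by
  have hre : IntervalIntegrable (fun t => (g t).re) volume 0 x := ⟨hg.1.re, hg.2.re⟩
  have him : IntervalIntegrable (fun t => (g t).im) volume 0 x := ⟨hg.1.im, hg.2.im⟩
  have key : ∀ y ∈ uIcc 0 x, ∫ t in 0..y, g t
      = ((∫ t in 0..y, (g t).re : ℝ) : ℂ) + ((∫ t in 0..y, (g t).im : ℝ) : ℂ) * Complex.I := by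
    intro y hy
    have hsub : uIcc 0 y ⊆ uIcc 0 x := uIcc_subset_uIcc_left hy
    rw [← intervalIntegral.integral_ofReal, ← intervalIntegral.integral_ofReal,
      ← intervalIntegral.integral_mul_const, ← intervalIntegral.integral_add]
    · simp only [Complex.re_add_im]
    · exact intervalIntegrable_ofReal (hre.mono_set hsub)
    · exact (intervalIntegrable_ofReal (him.mono_set hsub)).mul_const _
  have hint : ∀ h : ℝ → ℝ, IntervalIntegrable h volume 0 x → IntervalIntegrable
      (fun t => deriv A t * (∫ r in 0..t, h r) + A t * h t) volume 0 x := by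
    intro h hh
    have hv := hh.absolutelyContinuousOnInterval_intervalIntegral (c := 0) (by simp)
    exact (hA.intervalIntegrable_deriv.mul_continuousOn hv.continuousOn).add
      (hh.continuousOn_mul hA.continuousOn)
  rw [key x right_mem_uIcc, mul_add, ← mul_assoc, ← Complex.ofReal_mul, ← Complex.ofReal_mul,
    mul_primitive hA hre, mul_primitive hA him, ← intervalIntegral.integral_ofReal,
    ← intervalIntegral.integral_ofReal, ← intervalIntegral.integral_mul_const,
    ← intervalIntegral.integral_add (intervalIntegrable_ofReal (hint _ hre))
      ((intervalIntegrable_ofReal (hint _ him)).mul_const _)]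
  refine intervalIntegral.integral_congr fun t ht => ?_
  rw [key t ht]
  have e : g t = (g t).re + (g t).im * Complex.I := (Complex.re_add_im _).symm
  generalize (g t).re = a at *
  generalize (g t).im = b at *
  rw [e]
  push_cast
  ring

namespace Horn

variable (W : Horn)

theorem continuousOn_area : ContinuousOn (fun x => (W.A x : ℂ)) (Icc 0 W.ℓ) :=
  Complex.continuous_ofReal.comp_continuousOn W.continuousOn_A

theorem continuousOn_area_inv : ContinuousOn (fun x => ((W.A x)⁻¹ : ℂ)) (Icc 0 W.ℓ) :=
  W.continuousOn_area.inv₀ fun x hx => by exact_mod_cast (W.A_pos x hx).ne'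

theorem area_mul_mem (f : H1 W.ℓ) :
    mulOp (fun x => (W.A x : ℂ)) W.continuousOn_area (f : L2 W.ℓ) ∈ H1 W.ℓ := by
  have hf := H1.isACRep f
  set u := H1.rep f
  set g := H1.derivFun f
  have hA' : MemLp (fun x => ((deriv W.A x : ℝ) : ℂ)) 2 (volume.restrict (Ioo 0 W.ℓ)) :=
    W.A_deriv.ofReal
  have h1 : MemLp (fun x => u x * ((deriv W.A x : ℝ) : ℂ)) 2 (volume.restrict (Ioo 0 W.ℓ)) :=
    memLp_mul hf.continuousOn hA'
  have h2 : MemLp (fun x => (W.A x : ℂ) * g x) 2 (volume.restrict (Ioo 0 W.ℓ)) :=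
    memLp_mul W.continuousOn_area (Lp.memLp g)
  refine ⟨(h1.add h2).toLp _, fun x => (W.A x : ℂ) * u x, ?_, fun x hx => ?_⟩
  · refine (MemLp.coeFn_toLp (memLp_mul W.continuousOn_area (Lp.memLp (f : L2 W.ℓ)))).trans ?_
    filter_upwards [hf.ae_eq] with x hx
    rw [hx]
  · rw [intervalIntegral_congr (MemLp.coeFn_toLp _) hx]
    have hsub : uIcc 0 x ⊆ uIcc 0 W.ℓ := by
      rw [uIcc_of_le hx.1, uIcc_of_le W.ℓ_pos.le]; exact Icc_subset_Icc_right hx.2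
    have hAx := W.A_ac.mono hsub
    have hgx := intervalIntegrable g hx
    have hcx : ∀ t ∈ uIcc 0 x, u t = u 0 + ∫ r in 0..t, g r := fun t ht =>
      hf.eq_integral t (by rw [uIcc_of_le hx.1] at ht; exact ⟨ht.1, ht.2.trans hx.2⟩)
    have hA'x : IntervalIntegrable (fun t => ((deriv W.A t : ℝ) : ℂ)) volume 0 x :=
      intervalIntegrable_ofReal hAx.intervalIntegrable_deriv
    have hcont : ContinuousOn (fun t => ∫ r in 0..t, g r) (uIcc 0 x) := by
      refine ((hf.continuousOn.mono ?_).sub (continuousOn_const (c := u 0))).congr ?_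
      · rw [uIcc_of_le hx.1]; exact Icc_subset_Icc_right hx.2
      · intro t ht
        simp [hcx t ht]
    have hi : IntervalIntegrable (fun t => ((deriv W.A t : ℝ) : ℂ) * (∫ r in 0..t, g r)
        + (W.A t : ℂ) * g t) volume 0 x :=
      (hA'x.mul_continuousOn hcont).add (hgx.continuousOn_mul (by
        rw [uIcc_of_le hx.1]
        exact W.continuousOn_area.mono (Icc_subset_Icc_right hx.2)))
    have e1 : ∫ t in 0..x, ((fun x => u x * ((deriv W.A x : ℝ) : ℂ)) + fun x => (W.A x : ℂ) * g x) t
        = ∫ t in 0..x, (((deriv W.A t : ℝ) : ℂ) * u 0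
          + (((deriv W.A t : ℝ) : ℂ) * (∫ r in 0..t, g r) + (W.A t : ℂ) * g t)) := by
      refine intervalIntegral.integral_congr fun t ht => ?_
      simp only [Pi.add_apply]
      rw [hcx t ht]
      ring
    rw [e1, intervalIntegral.integral_add (hA'x.mul_const _) hi,
      ← mul_primitive_complex hAx hgx, intervalIntegral.integral_mul_const,
      intervalIntegral.integral_ofReal, hAx.integral_deriv_eq_sub, hcx x right_mem_uIcc]
    push_cast
    ring

/-- `f ↦ A f` on `H¹(0,ℓ)`. -/
def mulArea : H1 W.ℓ →ₗ[ℂ] H1 W.ℓ :=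
  ((mulOp (fun x => (W.A x : ℂ)) W.continuousOn_area).comp (H1 W.ℓ).subtype).codRestrict _
    W.area_mul_mem

/-- `g ↦ (1/A) (A g)'` from `H¹(0,ℓ)` to `L²(0,ℓ)`; for `g = w'` with `w ∈ H²(0,ℓ)` this is
Webster's operator `(1/A) (A w')'` applied to `w`. -/
def divArea : H1 W.ℓ →ₗ[ℂ] L2 W.ℓ :=
  (mulOp (fun x => ((W.A x)⁻¹ : ℂ)) W.continuousOn_area_inv).comp
    ((H1.deriv W.ℓ_pos).comp W.mulArea)

/-- The state space `H¹_{ℓ}(0,ℓ) × L²(0,ℓ)`; a state is `(w₁, w₂) = (ψ, π)`, with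
`π = ρ ψ_t`. -/
abbrev State : Type := WithLp 2 (H1D W.ℓ × L2 W.ℓ)

/-- The state space is a Hilbert space. -/
instance completeSpace_state : CompleteSpace W.State := by
  have : CompleteSpace (H1D W.ℓ) := (isClosed_H1D W.ℓ_pos).completeSpace_coe
  infer_instance

/-- The domain `H²_{ℓ}(0,ℓ) × H¹_{ℓ}(0,ℓ)`: the `(w₁, w₂)` with `w₁ ∈ H¹_{ℓ}`, `w₁' ∈ H¹`,
and `w₂ ∈ H¹`, `w₂(ℓ) = 0`. -/
def domain : Submodule ℂ W.State where
  carrier := {z | (z.fst : WithLp 2 (L2 W.ℓ × L2 W.ℓ)).snd ∈ H1 W.ℓ ∧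
    ∃ h : z.snd ∈ H1 W.ℓ, H1.eval W.ℓ_pos W.ℓ W.ℓ_mem ⟨z.snd, h⟩ = 0}
  zero_mem' := ⟨(H1 W.ℓ).zero_mem, (H1 W.ℓ).zero_mem, map_zero (H1.eval W.ℓ_pos W.ℓ W.ℓ_mem)⟩
  add_mem' := by
    rintro z z' ⟨h1, h2, h3⟩ ⟨h1', h2', h3'⟩
    refine ⟨(H1 W.ℓ).add_mem h1 h1', (H1 W.ℓ).add_mem h2 h2', ?_⟩
    have := map_add (H1.eval W.ℓ_pos W.ℓ W.ℓ_mem) ⟨z.snd, h2⟩ ⟨z'.snd, h2'⟩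
    rw [h3, h3', add_zero] at this
    exact this
  smul_mem' := by
    rintro c z ⟨h1, h2, h3⟩
    refine ⟨(H1 W.ℓ).smul_mem c h1, (H1 W.ℓ).smul_mem c h2, ?_⟩
    have := map_smul (H1.eval W.ℓ_pos W.ℓ W.ℓ_mem) c ⟨z.snd, h2⟩
    rw [h3, smul_zero] at this
    exact this

/-- `(w₁, w₂) ↦ w₁' ∈ H¹(0,ℓ)`. -/
def slope : W.domain →ₗ[ℂ] H1 W.ℓ where
  toFun z := ⟨((z : W.State).fst : WithLp 2 (L2 W.ℓ × L2 W.ℓ)).snd, z.2.1⟩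
  map_add' _ _ := rfl
  map_smul' _ _ := rfl

/-- `(w₁, w₂) ↦ w₂ ∈ H¹(0,ℓ)`. -/
def momentum : W.domain →ₗ[ℂ] H1 W.ℓ where
  toFun z := ⟨(z : W.State).snd, z.2.2.1⟩
  map_add' _ _ := rfl
  map_smul' _ _ := rfl

/-- `(w₁, w₂) ↦ w₂`, as an element of `H¹_{ℓ}(0,ℓ)`, i.e. as the pair `(w₂, w₂')`. -/
def momentumD : W.domain →ₗ[ℂ] H1D W.ℓ where
  toFun z := ⟨WithLp.toLp 2 ((W.momentum z : L2 W.ℓ), H1.deriv W.ℓ_pos (W.momentum z)),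
    H1.rep (W.momentum z), H1.isACRep (W.momentum z), z.2.2.2⟩
  map_add' z z' := by
    ext1
    simp only [map_add, Submodule.coe_add]
    rfl
  map_smul' c z := by
    ext1
    simp only [map_smul, Submodule.coe_smul]
    rfl

/-- Webster's horn model as a boundary control system `(G, L, K)` with
`G (w₁, w₂) = -A(0) w₁'(0)`, `L (w₁, w₂) = (ρ⁻¹ w₂, ρ c² (1/A) (A w₁')')`, and
`K (w₁, w₂) = w₂(0)`.  The Dirichlet condition at `ℓ` is part of the domain. -/
def node : Colligation ℂ W.State ℂ where
  dom := W.domain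
  G := (-(W.A 0 : ℂ)) • (H1.eval W.ℓ_pos 0 W.zero_mem).comp W.slope
  L := (WithLp.linearEquiv 2 ℂ (H1D W.ℓ × L2 W.ℓ)).symm.toLinearMap.comp
    (LinearMap.prod ((W.ρ⁻¹ : ℂ) • W.momentumD)
      ((W.ρ * W.c ^ 2 : ℂ) • W.divArea.comp W.slope))
  K := (H1.eval W.ℓ_pos 0 W.zero_mem).comp W.momentum

/-- The impedance transfer function `Z_ac(s)` of the horn, from the input `i₀` to the output
`p₀`. -/
def impedance (s : ℂ) : ℂ := W.node.transferFunction s 1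

/-- The flow mechanical inertance `C_iner = ρ ∫₀^ℓ dx / A(x)`. -/
def inertance : ℝ := W.ρ * ∫ x in 0..W.ℓ, 1 / W.A x

end Horn

/-- `r` is the inertial factor of the acoustic impedance `Z` relative to the inertial impedance
`Z_iner(s) = C s`: `Z(s) / Z_iner(s) → r` as `s → 0` in `ℂ`. -/
def HasInertialFactor (Z : ℂ → ℂ) (C r : ℝ) : Prop :=
  Tendsto (fun s : ℂ => Z s / ((C : ℂ) * s)) (𝓝[≠] 0) (𝓝 (r : ℂ))

/-- The termination that gives rise to the acoustic impedance `Z` is inertially feasible. -/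
def InertiallyFeasible (Z : ℂ → ℂ) (C : ℝ) : Prop := ∃ r : ℝ, HasInertialFactor Z C r

end Webster

end

noncomputable section

/-! ### Resolvents and transfer functions of colligations -/

namespace Colligation

variable {U X Y : Type*} [NormedAddCommGroup U] [NormedSpace ℂ U]
  [NormedAddCommGroup X] [NormedSpace ℂ X] [NormedAddCommGroup Y] [NormedSpace ℂ Y]
  {Ξ : Colligation U X Y} {s t : ℂ} {R R' : X →L[ℂ] X}

/-! At frequency zero the boundary problem is solved explicitly. The state `unitFlow`, with `A w₁' =
-1` and `w₂ = 0`, is stationary, carries unit input and gives zero output; hence the impedance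
vanishes at `0`. The main operator is inverted just as explicitly: `-L w = (h₁, h₂)` decouples into
`w₂ = -ρ h₁` and an equation for `A w₁'` solved by integrating from `0`. This gives the bounded
operator `negInv`, and `K ∘ negInv` is the bounded functional `outputInv`.

The rest is abstract. If `R = (-A)⁻¹` with `A = L|ker G`, and `L z₀ = 0`, `G z₀ = 1`, then `z₀ - s
(s - A)⁻¹ z₀` satisfies `L z = s z` and still has input `1`. With `(s - A)⁻¹ = R (1 + s R)⁻¹` and `κ
= K R`, the transfer function near `0` is `K z₀ - s κ (1 + s R)⁻¹ z₀`, whose derivative at `0` is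
`-κ z₀` (`transferFunction_eq`, `hasDerivAt_transferFunction`). For the horn `κ (w₁, w₂) = -ρ
w₁(0)`, and `unitFlow` has `w₁(0) = ∫₀^ℓ 1/A`, which produces the inertance.

The same `z₀`, `R` and `κ` describe the graph of `(G, L, K)` by continuous equations, so it is
closed; density of `ker G` comes from density of `H¹₀` in `L²`. -/

theorem isResolvent_resolvent (hs : s ∈ Ξ.resolventSet) : Ξ.IsResolvent s (Ξ.resolvent s) := by
  have h : ∃ R, Ξ.IsResolvent s R := hs
  have e : Ξ.resolvent s = h.choose := dif_pos hs
  rw [e]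
  exact h.choose_spec

/-- The resolvent identity. -/
theorem IsResolvent.add_smul_comp (hR : Ξ.IsResolvent s R) (hR' : Ξ.IsResolvent t R') (x : X) :
    R x + (s - t) • R (R' x) = R' x := by
  obtain ⟨h, hG, hx⟩ := hR'.right_inv x
  have h1 := hR.left_inv ⟨R' x, h⟩ hG
  have e : s • R' x - Ξ.L ⟨R' x, h⟩ = x + (s - t) • R' x := by
    nth_rewrite 3 [← hx]
    module
  rwa [e, map_add, map_smul] at h1

/-- Formally `1 + (t - s) R = (t - A)(s - A)⁻¹`. Its inverse is the same expression with the roles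
of `s` and `t` exchanged, by the resolvent identity. -/
theorem IsResolvent.isUnit_one_add (hR : Ξ.IsResolvent s R) (hR' : Ξ.IsResolvent t R') :
    IsUnit (1 + (t - s) • R) := by
  have key : ∀ {s t : ℂ} {R R' : X →L[ℂ] X}, Ξ.IsResolvent s R → Ξ.IsResolvent t R' →
      (1 + (t - s) • R) * (1 + (s - t) • R') = 1 := by
    intro s t R R' hR hR'
    ext x
    have h := hR.add_smul_comp hR' x
    simp only [mul_apply_eq_comp, add_apply,
      smul_apply, one_apply_eq_self, map_add, map_smul]
    nth_rewrite 1 [← h]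
    module
  exact ⟨⟨_, _, key hR hR', key hR' hR⟩, rfl⟩

/-- On `dom A` one has `t - A = (1 + (t - s) R)(s - A)`, so inverting the bounded factor inverts `t
- A`. -/
theorem IsResolvent.of_isUnit (hR : Ξ.IsResolvent s R) (hu : IsUnit (1 + (t - s) • R)) :
    Ξ.IsResolvent t (R * Ring.inverse (1 + (t - s) • R)) where
  right_inv x := by
    obtain ⟨h, hG, hx⟩ := hR.right_inv (Ring.inverse (1 + (t - s) • R) x)
    refine ⟨h, hG, ?_⟩
    have h1 := DFunLike.congr_fun (Ring.mul_inverse_cancel _ hu) x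
    simp only [mul_apply_eq_comp, add_apply,
      smul_apply, one_apply_eq_self] at h1
    change t • R (Ring.inverse (1 + (t - s) • R) x)
      - Ξ.L ⟨R (Ring.inverse (1 + (t - s) • R) x), h⟩ = x
    linear_combination (norm := module) hx + h1
  left_inv z hz := by
    have h1 := hR.left_inv z hz
    have e : t • (z : X) - Ξ.L z = (1 + (t - s) • R) (s • (z : X) - Ξ.L z) := by
      simp only [add_apply, smul_apply,
        one_apply_eq_self, h1]
      module
    rw [e, ← mul_apply_eq_comp, mul_assoc, Ring.inverse_mul_cancel _ hu, mul_one, h1]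

/-- Two preimages of the same input differ by an element of `ker G`, where `L` coincides with `A₋₁`;
so the chosen preimage in `control` may be replaced by any `z`. -/
theorem control_G (hΞ : Ξ.resolventSet.Nonempty) (z : Ξ.dom) :
    Ξ.control (Ξ.G z) = Ξ.embed (Ξ.L z) - Ξ.extGen (z : X) := by
  have hβ : Ξ.IsResolvent Ξ.base Ξ.embed := isResolvent_resolvent (Classical.epsilon_spec hΞ)
  have h : ∃ z' : Ξ.dom, Ξ.G z' = Ξ.G z := ⟨z, rfl⟩
  have e : Ξ.control (Ξ.G z) = Ξ.embed (Ξ.L h.choose) - Ξ.extGen (h.choose : X) := dif_pos h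
  rw [e]
  have h1 := hβ.left_inv (h.choose - z) (by rw [map_sub, h.choose_spec, sub_self])
  generalize h.choose = y at *
  simp only [extGen, sub_apply, smul_apply,
    ContinuousLinearMap.id_apply, map_sub, map_smul, Submodule.coe_sub] at h1 ⊢
  linear_combination (norm := module) -h1

/-- The transfer function maps `G z` to `K z` for every `z ∈ dom Ξ` with `L z = s z`. -/
theorem transferFunction_G (hs : s ∈ Ξ.resolventSet) (z : Ξ.dom) (hz : Ξ.L z = s • (z : X)) :
    Ξ.transferFunction s (Ξ.G z) = Ξ.K z := by
  have hβ : Ξ.IsResolvent Ξ.base Ξ.embed := isResolvent_resolvent (Classical.epsilon_spec ⟨s, hs⟩)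
  -- With `β - A₋₁` realised as the identity, `s - A₋₁` becomes the operator that `isUnit_one_add`
  -- inverts.
  have e : s • Ξ.embed - Ξ.extGen = 1 + (s - Ξ.base) • Ξ.embed := by
    rw [extGen, ← ContinuousLinearMap.one_def]
    module
  have hu := hβ.isUnit_one_add (isResolvent_resolvent hs)
  have h1 : Ξ.extResolvent s (Ξ.control (Ξ.G z)) = z := by
    -- `L z = s z` turns `B G z = L z - A₋₁ z` into `(s - A₋₁) z`.
    have e2 : Ξ.control (Ξ.G z) = (s • Ξ.embed - Ξ.extGen) (z : X) := by
      rw [control_G ⟨s, hs⟩, hz, map_smul]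
      rfl
    rw [e2, extResolvent, e, ← mul_apply_eq_comp, Ring.inverse_mul_cancel _ hu]
    rfl
  rw [transferFunction, h1]
  exact dif_pos ⟨z.2, rfl⟩

/-- If `0 ∈ ρ(A)` and `L z₀ = 0`, then `dom Ξ = span {z₀} + ker G`, and the values of the
transfer function near `0` come from the Neumann series for the resolvent. -/
theorem IsResolvent.transferFunction_eq (hR : Ξ.IsResolvent 0 R) {z₀ : Ξ.dom} (hz₀ : Ξ.L z₀ = 0)
    {κ : X →L[ℂ] Y} (hκ : ∀ x (h : R x ∈ Ξ.dom), Ξ.K ⟨R x, h⟩ = κ x)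
    (hu : IsUnit (1 + s • R)) :
    Ξ.transferFunction s (Ξ.G z₀) = Ξ.K z₀ - s • κ (Ring.inverse (1 + s • R) z₀) := by
  have hs : Ξ.IsResolvent s (R * Ring.inverse (1 + s • R)) := by
    simpa using hR.of_isUnit (t := s) (by simpa using hu)
  obtain ⟨h, hG, hx⟩ := hs.right_inv z₀
  -- Subtracting `s (s - A)⁻¹ z₀`, which lies in `ker G`, keeps the input and turns `L z₀ = 0` into
  -- `L z = s z`.
  have h1 := transferFunction_G ⟨_, hs⟩ (z₀ - s • ⟨_, h⟩) (by
    rw [map_sub, map_smul, hz₀, Submodule.coe_sub, Submodule.coe_smul, zero_sub]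
    nth_rewrite 2 [← hx]
    module)
  rw [map_sub, map_smul, hG, smul_zero, sub_zero] at h1
  rw [h1, map_sub, map_smul]
  congr 2
  exact hκ _ h

/-- The formula of `transferFunction_eq` is a constant minus `s` times a function of `s`, so only
continuity of that function at `0` is needed. Completeness makes invertibility an open condition and
inversion continuous at `1`. -/
theorem IsResolvent.hasDerivAt_transferFunction [CompleteSpace X] (hR : Ξ.IsResolvent 0 R)
    {z₀ : Ξ.dom} (hz₀ : Ξ.L z₀ = 0)
    {κ : X →L[ℂ] Y} (hκ : ∀ x (h : R x ∈ Ξ.dom), Ξ.K ⟨R x, h⟩ = κ x) :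
    HasDerivAt (fun s => Ξ.transferFunction s (Ξ.G z₀)) (-κ z₀) 0 := by
  have hc : Continuous fun s : ℂ => 1 + s • R := by fun_prop
  have hev : ∀ᶠ s : ℂ in 𝓝 0, IsUnit (1 + s • R) :=
    (Units.isOpen.preimage hc).mem_nhds (by simp)
  have h0 : ContinuousAt (fun s : ℂ => κ (Ring.inverse (1 + s • R) z₀)) 0 := by
    have h1 : ContinuousAt Ring.inverse (1 + (0 : ℂ) • R) := by
      simpa using NormedRing.inverse_continuousAt (1 : (X →L[ℂ] X)ˣ)
    have h2 : ContinuousAt (fun s : ℂ => Ring.inverse (1 + s • R)) 0 :=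
      h1.comp (f := fun s : ℂ => 1 + s • R) hc.continuousAt
    exact κ.continuous.continuousAt.comp (h2.clm_apply continuousAt_const)
  have h1 : HasDerivAt (fun s : ℂ => Ξ.K z₀ - s • κ (Ring.inverse (1 + s • R) z₀)) (-κ z₀) 0 := by
    rw [hasDerivAt_iff_tendsto_slope]
    have h2 : Tendsto (fun s : ℂ => -κ (Ring.inverse (1 + s • R) z₀)) (𝓝[≠] 0) (𝓝 (-κ z₀)) := by
      have := h0.tendsto.mono_left (nhdsWithin_le_nhds (s := {0}ᶜ))
      rw [zero_smul, add_zero, Ring.inverse_one] at this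
      exact this.neg
    refine h2.congr' ?_
    filter_upwards [self_mem_nhdsWithin] with s hs
    have hs : s ≠ 0 := hs
    simp [slope, smul_smul, hs]
  exact h1.congr_of_eventuallyEq (hev.mono fun s hs => hR.transferFunction_eq hz₀ hκ hs)

/-- A colligation with scalar input is a boundary node if `0 ∈ ρ(A)`, `ker G` is dense, the
problem `L z₀ = 0`, `G z₀ = 1` is solvable and `K A⁻¹` is bounded. -/
theorem IsResolvent.isBoundaryNode {Ξ : Colligation ℂ X Y} (hR : Ξ.IsResolvent 0 R)
    {z₀ : Ξ.dom} (hG₀ : Ξ.G z₀ = 1) (hz₀ : Ξ.L z₀ = 0)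
    {κ : X →L[ℂ] Y} (hκ : ∀ x (h : R x ∈ Ξ.dom), Ξ.K ⟨R x, h⟩ = κ x)
    (hd : Dense {x : X | ∃ h : x ∈ Ξ.dom, Ξ.G ⟨x, h⟩ = 0}) : Ξ.IsBoundaryNode where
  isClosed_graph := by
    -- Each `z - G z • z₀` lies in `ker G` and equals `-R (L z)`. The graph is therefore
    -- parametrised by the pair `(G z, L z)`, which is arbitrary.
    have e : {p : X × ℂ × X × Y | ∃ z : Ξ.dom, p = ((z : X), Ξ.G z, Ξ.L z, Ξ.K z)}
        = {p | p.1 = p.2.1 • (z₀ : X) - R p.2.2.1 ∧ p.2.2.2 = p.2.1 • Ξ.K z₀ - κ p.2.2.1} := by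
      ext ⟨x, g, y, k⟩
      simp only [mem_ofPred_eq, Prod.mk.injEq]
      constructor
      · rintro ⟨z, rfl, rfl, rfl, rfl⟩
        have h1 := hR.left_inv (z - Ξ.G z • z₀) (by simp [hG₀])
        have h2 : (z : X) - Ξ.G z • (z₀ : X) = -R (Ξ.L z) := by simpa [hz₀] using h1.symm
        have h3 : -R (Ξ.L z) = R (-Ξ.L z) := (map_neg R _).symm
        refine ⟨by rw [sub_eq_add_neg, ← h2]; abel, ?_⟩
        have h4 : R (-Ξ.L z) ∈ Ξ.dom := by
          rw [← h3, ← h2]; exact (z - Ξ.G z • z₀).2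
        have h5 := hκ _ h4
        have h6 : (⟨R (-Ξ.L z), h4⟩ : Ξ.dom) = z - Ξ.G z • z₀ :=
          Subtype.ext (h3.symm.trans h2.symm)
        rw [h6, map_sub, map_smul, map_neg] at h5
        rw [sub_eq_add_neg, ← h5]
        abel
      · rintro ⟨rfl, rfl⟩
        obtain ⟨h, hG, hx⟩ := hR.right_inv y
        rw [zero_smul, zero_sub, neg_eq_iff_eq_neg] at hx
        refine ⟨g • z₀ - ⟨R y, h⟩, rfl, ?_, ?_, ?_⟩
        · simp [hG, hG₀]
        · simp [hx, hz₀]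
        · simp [hκ]
    rw [e]
    exact (isClosed_eq (by fun_prop) (by fun_prop)).inter
      (isClosed_eq (by fun_prop) (by fun_prop))
  surjective_G u := ⟨u • z₀, by simp [hG₀]⟩
  dense_ker := hd
  resolventSet_nonempty := ⟨0, R, hR⟩

end Colligation

/-! ### Reciprocals of absolutely continuous functions -/

theorem AbsolutelyContinuousOnInterval.lipschitzOnWith_comp {f φ : ℝ → ℝ} {a b : ℝ} {s : Set ℝ}
    {C : NNReal} (hf : AbsolutelyContinuousOnInterval f a b) (hφ : LipschitzOnWith C φ s)
    (hs : MapsTo f (uIcc a b) s) : AbsolutelyContinuousOnInterval (fun x => φ (f x)) a b := by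
  have h := Filter.Tendsto.const_mul (C : ℝ) hf
  rw [mul_zero] at h
  refine squeeze_zero' (Eventually.of_forall fun E => Finset.sum_nonneg fun _ _ => dist_nonneg)
    ?_ h
  -- The principal part of the filter keeps all interval endpoints in `uIcc a b`, where the
  -- Lipschitz bound applies.
  filter_upwards [mem_inf_of_right (mem_principal_self _)] with E hE
  rw [Finset.mul_sum]
  exact Finset.sum_le_sum fun i hi =>
    hφ.dist_le_mul _ (hs (hE.1 i hi).1) _ (hs (hE.1 i hi).2)

namespace Webster

namespace Horn

variable (W : Horn)

theorem exists_pos_le_A : ∃ m > 0, ∀ x ∈ Icc 0 W.ℓ, m ≤ W.A x := by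
  obtain ⟨x, hx, hmin⟩ := isCompact_Icc.exists_isMinOn ⟨0, W.zero_mem⟩ W.continuousOn_A
  exact ⟨W.A x, W.A_pos x hx, fun y hy => hmin hy⟩

/-- The horn with the reciprocal area function. -/
def recip : Horn where
  ℓ := W.ℓ
  ρ := W.ρ
  c := W.c
  A := fun x => (W.A x)⁻¹
  ℓ_pos := W.ℓ_pos
  ρ_pos := W.ρ_pos
  c_pos := W.c_pos
  A_pos x hx := inv_pos.mpr (W.A_pos x hx)
  A_ac := by
    obtain ⟨m, hm, hA⟩ := W.exists_pos_le_A
    -- `|1/x - 1/y| = |x - y| / (x y)`, and both factors of the denominator are at least `m`.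
    have hφ : LipschitzOnWith (Real.toNNReal (m ^ 2)⁻¹) (fun y : ℝ => y⁻¹) (Ici m) := by
      refine LipschitzOnWith.of_dist_le_mul fun x hx y hy => ?_
      have hx : m ≤ x := hx
      have hy : m ≤ y := hy
      have hx0 : 0 < x := hm.trans_le hx
      have hy0 : 0 < y := hm.trans_le hy
      rw [Real.coe_toNNReal _ (by positivity), Real.dist_eq, Real.dist_eq,
        inv_sub_inv hx0.ne' hy0.ne', abs_div, abs_of_pos (mul_pos hx0 hy0), abs_sub_comm,
        div_eq_inv_mul]
      gcongr
      rw [sq]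
      gcongr
    refine W.A_ac.lipschitzOnWith_comp hφ fun x hx => hA x ?_
    rwa [uIcc_of_le W.ℓ_pos.le] at hx
  A_deriv := by
    obtain ⟨m, hm, hA⟩ := W.exists_pos_le_A
    refine W.A_deriv.of_le_mul (c := (m ^ 2)⁻¹) (aestronglyMeasurable_deriv _ _) ?_
    rw [ae_restrict_iff' measurableSet_Ioo]
    -- Absolute continuity gives differentiability almost everywhere, where `(1/A)' = -A'/A²` is
    -- dominated by `m⁻² |A'|`.
    filter_upwards [W.A_ac.ae_differentiableAt] with x hd hx
    have hx' : x ∈ Icc 0 W.ℓ := Ioo_subset_Icc_self hx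
    have h0 := W.A_pos x hx'
    rw [deriv_fun_inv'' (hd (by rwa [uIcc_of_le W.ℓ_pos.le])) h0.ne', norm_div, norm_neg,
      norm_pow, Real.norm_of_nonneg h0.le, div_eq_inv_mul]
    gcongr
    exact hA x hx'

end Horn

/-! ### Operators on `L²(0,ℓ)` -/

theorem coeFn_mulOp {ℓ : ℝ} (m : ℝ → ℂ) (hm : ContinuousOn m (Icc 0 ℓ)) (f : L2 ℓ) :
    mulOp m hm f =ᵐ[volume.restrict (Ioo 0 ℓ)] fun x => m x * f x :=
  MemLp.coeFn_toLp (memLp_mul hm (Lp.memLp f))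

theorem continuous_mulOp {ℓ : ℝ} (m : ℝ → ℂ) (hm : ContinuousOn m (Icc 0 ℓ)) :
    Continuous (mulOp m hm) := by
  obtain ⟨C, hC⟩ := isCompact_Icc.exists_bound_of_continuousOn hm
  refine AddMonoidHomClass.continuous_of_bound (mulOp m hm) C fun f => ?_
  refine Lp.norm_le_mul_norm_of_ae_le_mul ?_
  filter_upwards [coeFn_mulOp m hm f, ae_restrict_mem measurableSet_Ioo] with x h hx
  rw [h, norm_mul]
  gcongr
  exact hC x (Ioo_subset_Icc_self hx)

theorem mulOp_mulOp {ℓ : ℝ} {m n : ℝ → ℂ} (hm : ContinuousOn m (Icc 0 ℓ))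
    (hn : ContinuousOn n (Icc 0 ℓ)) (h : ∀ x ∈ Icc 0 ℓ, m x * n x = 1) (f : L2 ℓ) :
    mulOp m hm (mulOp n hn f) = f := by
  refine Lp.ext ?_
  filter_upwards [coeFn_mulOp m hm (mulOp n hn f), coeFn_mulOp n hn f,
    ae_restrict_mem measurableSet_Ioo] with x h1 h2 hx
  rw [h1, h2, ← mul_assoc, h x (Ioo_subset_Icc_self hx), one_mul]

theorem memLp_of_continuousOn {ℓ : ℝ} {u : ℝ → ℂ} (hu : ContinuousOn u (Icc 0 ℓ)) :
    MemLp u 2 (volume.restrict (Ioo 0 ℓ)) := by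
  simpa using memLp_mul hu (memLp_const (1 : ℂ))

theorem continuousOn_primitive {ℓ : ℝ} (hℓ : 0 < ℓ) (g : L2 ℓ) :
    ContinuousOn (fun x => ∫ t in 0..x, g t) (Icc 0 ℓ) := by
  have hi : IntegrableOn g (uIcc 0 ℓ) volume := by
    rw [uIcc_of_le hℓ.le]
    exact (integrableOn g).congr_set_ae Ioc_ae_eq_Icc.symm
  have := intervalIntegral.continuousOn_primitive_interval (a := 0) (b := ℓ) hi
  rwa [uIcc_of_le hℓ.le] at this

/-- `g ↦ ∫₀^ℓ g` on `L²(0,ℓ)`. -/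
def integralL {ℓ : ℝ} (hℓ : 0 < ℓ) : L2 ℓ →L[ℂ] ℂ where
  toFun g := ∫ t in 0..ℓ, g t
  map_add' f g := by
    rw [intervalIntegral_congr (Lp.coeFn_add f g) ⟨hℓ.le, le_rfl⟩]
    exact intervalIntegral.integral_add (intervalIntegrable f ⟨hℓ.le, le_rfl⟩)
      (intervalIntegrable g ⟨hℓ.le, le_rfl⟩)
  map_smul' c g := by
    rw [intervalIntegral_congr (Lp.coeFn_smul c g) ⟨hℓ.le, le_rfl⟩]
    exact intervalIntegral.integral_smul c _
  cont := continuous_primitive ⟨hℓ.le, le_rfl⟩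

/-- Differentiation `H¹_{ℓ}(0,ℓ) → L²(0,ℓ)`. -/
def derivL (ℓ : ℝ) : H1D ℓ →L[ℂ] L2 ℓ :=
  (WithLp.sndL 2 ℂ (L2 ℓ) (L2 ℓ)).comp (H1D ℓ).subtypeL

/-- A zero derivative leaves a constant, which the condition at `ℓ` kills. -/
theorem derivL_injective {ℓ : ℝ} (hℓ : 0 < ℓ) : (derivL ℓ).ker = ⊥ := by
  rw [eq_bot_iff]
  rintro ⟨p, u, hu, hu0⟩ hp
  have hp : p.snd = 0 := hp
  rw [hp] at hu
  have h0 : ∀ x ∈ Icc 0 ℓ, u x = u 0 := fun x hx => by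
    have := hu.eq_integral x hx
    rw [intervalIntegral_congr (Lp.coeFn_zero _ _ _) hx] at this
    simpa using this
  have h1 : p.fst = 0 := by
    refine Lp.ext ?_
    filter_upwards [hu.ae_eq, Lp.coeFn_zero ℂ 2 (volume.restrict (Ioo 0 ℓ)),
      ae_restrict_mem measurableSet_Ioo] with x h1 h2 hx
    rw [h1, h2, h0 x (Ioo_subset_Icc_self hx), ← h0 ℓ ⟨hℓ.le, le_rfl⟩, hu0]
    rfl
  refine Subtype.ext ?_
  exact WithLp.ofLp_injective 2 (Prod.ext h1 hp)

theorem derivL_surjective {ℓ : ℝ} (hℓ : 0 < ℓ) : (derivL ℓ).range = ⊤ := by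
  rw [eq_top_iff]
  intro g _
  -- The constant `-∫₀^ℓ g` makes the primitive vanish at `ℓ`.
  have hc : ContinuousOn (fun x => -(∫ t in 0..ℓ, g t) + ∫ t in 0..x, g t) (Icc 0 ℓ) :=
    continuousOn_const.add (continuousOn_primitive hℓ g)
  exact ⟨⟨WithLp.toLp 2 ((memLp_of_continuousOn hc).toLp _, g), _,
    ⟨MemLp.coeFn_toLp (memLp_of_continuousOn hc), fun x _ => by simp⟩, by simp⟩, rfl⟩

/-- `g ↦ -∫ₓ^ℓ g`, the inverse of differentiation `H¹_{ℓ}(0,ℓ) → L²(0,ℓ)`. -/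
def primitiveD {ℓ : ℝ} (hℓ : 0 < ℓ) : L2 ℓ ≃L[ℂ] H1D ℓ :=
  -- Completeness lets the open mapping theorem supply continuity of the inverse.
  have : CompleteSpace (H1D ℓ) := (isClosed_H1D hℓ).completeSpace_coe
  (ContinuousLinearEquiv.ofBijective (derivL ℓ) (derivL_injective hℓ) (derivL_surjective hℓ)).symm

theorem snd_primitiveD {ℓ : ℝ} (hℓ : 0 < ℓ) (g : L2 ℓ) :
    (primitiveD hℓ g : WithLp 2 (L2 ℓ × L2 ℓ)).snd = g :=
  (primitiveD hℓ).symm_apply_apply g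

theorem primitiveD_snd {ℓ : ℝ} (hℓ : 0 < ℓ) (w : H1D ℓ) :
    primitiveD hℓ (w : WithLp 2 (L2 ℓ × L2 ℓ)).snd = w :=
  (primitiveD hℓ).apply_symm_apply w

/-- The condition at `ℓ` fixes the constant of integration, so the representative is explicit in
terms of the derivative and its point values depend boundedly on the state. -/
theorem H1D.isACRep {ℓ : ℝ} (hℓ : 0 < ℓ) (w : H1D ℓ) :
    IsACRep (w : WithLp 2 (L2 ℓ × L2 ℓ)).fst (w : WithLp 2 (L2 ℓ × L2 ℓ)).snd
      fun x => -integralL hℓ (w : WithLp 2 (L2 ℓ × L2 ℓ)).snd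
        + ∫ t in 0..x, (w : WithLp 2 (L2 ℓ × L2 ℓ)).snd t := by
  obtain ⟨p, u, hu, hu0⟩ := w
  have e := hu.eq_integral ℓ ⟨hℓ.le, le_rfl⟩
  rw [hu0] at e
  refine ⟨?_, fun x _ => by simp⟩
  filter_upwards [hu.ae_eq, ae_restrict_mem measurableSet_Ioo] with x h hx
  rw [h, hu.eq_integral x (Ioo_subset_Icc_self hx), eq_neg_of_add_eq_zero_left e.symm]
  rfl

theorem IsACRep.mem_H1 {ℓ : ℝ} {f g : L2 ℓ} {u : ℝ → ℂ} (h : IsACRep f g u) : f ∈ H1 ℓ :=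
  ⟨g, u, h⟩

theorem IsACRep.deriv_eq {ℓ : ℝ} {f g : L2 ℓ} {u : ℝ → ℂ} (hℓ : 0 < ℓ) (h : IsACRep f g u)
    (hf : f ∈ H1 ℓ) : H1.deriv hℓ ⟨f, hf⟩ = g :=
  ((H1.isACRep ⟨f, hf⟩).unique hℓ h).1

theorem IsACRep.eval_eq {ℓ x : ℝ} {f g : L2 ℓ} {u : ℝ → ℂ} (hℓ : 0 < ℓ) (h : IsACRep f g u)
    (hf : f ∈ H1 ℓ) (hx : x ∈ Icc 0 ℓ) : H1.eval hℓ x hx ⟨f, hf⟩ = u x :=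
  ((H1.isACRep ⟨f, hf⟩).unique hℓ h).2 x hx

/-- The constant function `1`. -/
def oneL2 (ℓ : ℝ) : L2 ℓ := (memLp_const (1 : ℂ)).toLp fun _ => 1

theorem isACRep_one (ℓ : ℝ) : IsACRep (oneL2 ℓ) 0 fun _ => 1 where
  ae_eq := MemLp.coeFn_toLp _
  eq_integral x hx := by
    rw [intervalIntegral_congr (Lp.coeFn_zero _ _ _) hx]; simp

/-- The Volterra operator `g ↦ ∫₀ˣ g` on `L²(0,ℓ)`. -/
def volterra {ℓ : ℝ} (hℓ : 0 < ℓ) : L2 ℓ →L[ℂ] L2 ℓ :=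
  -- `∫₀ˣ g = -∫ₓ^ℓ g + ∫₀^ℓ g`: boundedness is inherited from `primitiveD` and `integralL`.
  (WithLp.fstL 2 ℂ (L2 ℓ) (L2 ℓ)).comp ((H1D ℓ).subtypeL.comp (primitiveD hℓ).toContinuousLinearMap)
    + (integralL hℓ).smulRight (oneL2 ℓ)

theorem isACRep_volterra {ℓ : ℝ} (hℓ : 0 < ℓ) (g : L2 ℓ) :
    IsACRep (volterra hℓ g) g fun x => ∫ t in 0..x, g t := by
  have h := (H1D.isACRep hℓ (primitiveD hℓ g)).add ((isACRep_one ℓ).smul (integralL hℓ g))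
  rw [snd_primitiveD, smul_zero, add_zero] at h
  have e : (fun x => ∫ t in 0..x, g t) = (fun x => -integralL hℓ g + ∫ t in 0..x, g t)
      + integralL hℓ g • fun _ => 1 := by
    ext x
    simp
  rw [e]
  exact h

theorem volterra_deriv {ℓ : ℝ} (hℓ : 0 < ℓ) (f : H1 ℓ)
    (h0 : H1.eval hℓ 0 ⟨le_rfl, hℓ.le⟩ f = 0) : volterra hℓ (H1.deriv hℓ f) = f := by
  have h0 : H1.rep f 0 = 0 := h0
  have h := H1.isACRep f
  refine Lp.ext ?_
  filter_upwards [h.ae_eq, (isACRep_volterra hℓ (H1.deriv hℓ f)).ae_eq,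
    ae_restrict_mem measurableSet_Ioo] with x h1 h2 hx
  rw [h1, h2, h.eq_integral x (Ioo_subset_Icc_self hx), h0, zero_add]
  rfl

/-! ### Density of `H¹₀(0,ℓ)` -/

/-- The space `H¹₀(0,ℓ)` as a subspace of `L²(0,ℓ)`. -/
def H10 (ℓ : ℝ) : Submodule ℂ (L2 ℓ) where
  carrier := {f | ∃ g u, IsACRep f g u ∧ u 0 = 0 ∧ u ℓ = 0}
  zero_mem' := ⟨0, 0, IsACRep.zero, rfl, rfl⟩
  add_mem' := by
    rintro f f' ⟨g, u, h, h0, h1⟩ ⟨g', u', h', h0', h1'⟩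
    exact ⟨_, _, h.add h', by simp [h0, h0'], by simp [h1, h1']⟩
  smul_mem' := by
    rintro c f ⟨g, u, h, h0, h1⟩
    exact ⟨_, _, h.smul c, by simp [h0], by simp [h1]⟩

theorem isACRep_of_contDiff (ℓ : ℝ) {φ : ℝ → ℝ} (hφ : ContDiff ℝ 1 φ) :
    ∃ f g : L2 ℓ, IsACRep f g fun x => (φ x : ℂ) := by
  have hd : Continuous (deriv φ) := hφ.continuous_deriv le_rfl
  have h1 := memLp_of_continuousOn (ℓ := ℓ) (u := fun x => (φ x : ℂ))
    (Complex.continuous_ofReal.comp hφ.continuous).continuousOn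
  have h2 := memLp_of_continuousOn (ℓ := ℓ) (u := fun x => ((deriv φ x : ℝ) : ℂ))
    (Complex.continuous_ofReal.comp hd).continuousOn
  refine ⟨h1.toLp _, h2.toLp _, MemLp.coeFn_toLp _, fun x hx => ?_⟩
  rw [intervalIntegral_congr (MemLp.coeFn_toLp h2) hx, intervalIntegral.integral_ofReal,
    intervalIntegral.integral_deriv_eq_sub (fun y _ => hφ.differentiable one_ne_zero y)
      (hd.intervalIntegrable _ _)]
  push_cast
  ring

/-- Smooth functions compactly supported in `(0, ℓ)` belong to `H10`, so anything orthogonal to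
`H10` vanishes by the fundamental lemma of the calculus of variations. -/
theorem dense_H10 (ℓ : ℝ) : Dense (H10 ℓ : Set (L2 ℓ)) := by
  rw [Submodule.dense_iff_topologicalClosure_eq_top, Submodule.topologicalClosure_eq_top_iff,
    eq_bot_iff]
  intro h hh
  rw [Submodule.mem_orthogonal] at hh
  have hloc : LocallyIntegrableOn h (Ioo 0 ℓ) volume :=
    IntegrableOn.locallyIntegrableOn ((Lp.memLp h).integrable (by norm_num))
  have key := isOpen_Ioo.ae_eq_zero_of_integral_contDiff_smul_eq_zero hloc
    fun φ hφ _ hsupp => by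
      have h0 : ∀ x ∉ Ioo 0 ℓ, φ x = 0 := fun x hx =>
        image_eq_zero_of_notMem_tsupport fun hx' => hx (hsupp hx')
      obtain ⟨f, g, hfg⟩ := isACRep_of_contDiff ℓ (hφ.of_le (by exact_mod_cast le_top))
      have h1 := hh f ⟨g, _, hfg, by simp [h0 0], by simp [h0 ℓ]⟩
      rw [L2.inner_def] at h1
      rw [← setIntegral_eq_integral_of_forall_compl_eq_zero (s := Ioo 0 ℓ)
        fun x hx => by rw [h0 x hx, zero_smul], ← h1]
      refine integral_congr_ae ?_
      filter_upwards [hfg.ae_eq] with x hx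
      rw [hx]
      -- The test function is real, so the conjugation in the inner product disappears.
      simp [mul_comm]
  refine (Lp.ext ?_ : h = 0)
  filter_upwards [(ae_restrict_iff' measurableSet_Ioo).mpr key,
    Lp.coeFn_zero ℂ 2 (volume.restrict (Ioo 0 ℓ))] with x h1 h2
  rw [h1, h2]
  rfl

/-- Continuous representatives agree on `[0, ℓ]`. This replaces the unspecified representative
coming from membership in `H1` by an explicit one, whose value at `0` can be read off. -/
theorem IsACRep.congr {ℓ : ℝ} {f g : L2 ℓ} {u v : ℝ → ℂ} (hℓ : 0 < ℓ) (h : IsACRep f g u)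
    (hv : ContinuousOn v (Icc 0 ℓ)) (hfv : f =ᵐ[volume.restrict (Ioo 0 ℓ)] v) :
    IsACRep f g v := by
  have h1 : EqOn u v (Ioo 0 ℓ) :=
    Measure.eqOn_open_of_ae_eq (h.ae_eq.symm.trans hfv) isOpen_Ioo
      (h.continuousOn.mono Ioo_subset_Icc_self) (hv.mono Ioo_subset_Icc_self)
  have h2 : EqOn u v (Icc 0 ℓ) :=
    h1.of_subset_closure h.continuousOn hv Ioo_subset_Icc_self (by rw [closure_Ioo hℓ.ne])
  refine ⟨hfv, fun x hx => ?_⟩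
  rw [← h2 hx, ← h2 ⟨le_rfl, hℓ.le⟩, h.eq_integral x hx]

namespace Horn

variable (W : Horn)

/-! ### Multiplication by the area function and its reciprocal -/

theorem isACRep_mulOp_area {f g : L2 W.ℓ} {u : ℝ → ℂ} (h : IsACRep f g u) :
    ∃ g', IsACRep (mulOp (fun x => (W.A x : ℂ)) W.continuousOn_area f) g'
      fun x => (W.A x : ℂ) * u x := by
  obtain ⟨g', v, hv⟩ := W.area_mul_mem ⟨f, h.mem_H1⟩
  refine ⟨g', hv.congr W.ℓ_pos (W.continuousOn_area.mul h.continuousOn) ?_⟩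
  filter_upwards [coeFn_mulOp _ W.continuousOn_area f, h.ae_eq] with x h1 h2
  rw [h1, h2]

/-- Multiplication by `1/A` on `L²(0,ℓ)`. -/
def mulInv : L2 W.ℓ →L[ℂ] L2 W.ℓ :=
  ⟨mulOp (fun x => ((W.A x)⁻¹ : ℂ)) W.continuousOn_area_inv, continuous_mulOp _ _⟩

/-- Division by `A` is multiplication by the area function of `W.recip`, so the product rule already
known for horns applies. -/
theorem isACRep_mulInv {f g : L2 W.ℓ} {u : ℝ → ℂ} (h : IsACRep f g u) :
    ∃ g', IsACRep (W.mulInv f) g' fun x => ((W.A x)⁻¹ : ℂ) * u x := by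
  have e : (fun x => ((W.A x)⁻¹ : ℂ)) = fun x => ((W.recip.A x : ℝ) : ℂ) := by
    ext x
    simp [recip]
  obtain ⟨g', hg'⟩ := W.recip.isACRep_mulOp_area (f := f) (g := g) h
  have e2 : W.mulInv f
      = mulOp (fun x => ((W.recip.A x : ℝ) : ℂ)) W.recip.continuousOn_area f := by
    change mulOp (fun x => ((W.A x)⁻¹ : ℂ)) W.continuousOn_area_inv f = _
    simp only [e]
    rfl
  have e3 : (fun x => ((W.A x)⁻¹ : ℂ) * u x) = fun x => ((W.recip.A x : ℝ) : ℂ) * u x :=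
    funext fun x => congrArg (· * u x) (congrFun e x)
  refine ⟨g', ?_⟩
  rw [e2, e3]
  exact hg'

theorem mulInv_mulOp_area (f : L2 W.ℓ) :
    W.mulInv (mulOp (fun x => (W.A x : ℂ)) W.continuousOn_area f) = f :=
  mulOp_mulOp W.continuousOn_area_inv W.continuousOn_area
    (fun x hx => inv_mul_cancel₀ (by exact_mod_cast (W.A_pos x hx).ne')) f

theorem mulOp_area_mulInv (f : L2 W.ℓ) :
    mulOp (fun x => (W.A x : ℂ)) W.continuousOn_area (W.mulInv f) = f :=
  mulOp_mulOp W.continuousOn_area W.continuousOn_area_inv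
    (fun x hx => mul_inv_cancel₀ (by exact_mod_cast (W.A_pos x hx).ne')) f

theorem divArea_mulInv {f g : L2 W.ℓ} {u : ℝ → ℂ} (h : IsACRep f g u)
    (hm : W.mulInv f ∈ H1 W.ℓ) : W.divArea ⟨W.mulInv f, hm⟩ = W.mulInv g := by
  have e : W.mulArea ⟨W.mulInv f, hm⟩ = ⟨f, h.mem_H1⟩ := Subtype.ext (W.mulOp_area_mulInv f)
  change W.mulInv (H1.deriv W.ℓ_pos (W.mulArea ⟨W.mulInv f, hm⟩)) = W.mulInv g
  rw [e, h.deriv_eq W.ℓ_pos]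

theorem eval_mulInv {f g : L2 W.ℓ} {u : ℝ → ℂ} (h : IsACRep f g u)
    (hm : W.mulInv f ∈ H1 W.ℓ) :
    H1.eval W.ℓ_pos 0 W.zero_mem ⟨W.mulInv f, hm⟩ = (W.A 0 : ℂ)⁻¹ * u 0 := by
  obtain ⟨g', hg'⟩ := W.isACRep_mulInv h
  exact hg'.eval_eq W.ℓ_pos hm W.zero_mem

/-! ### The inverse of the main operator -/

/-- `h ↦ -(ρ c² A)⁻¹ ∫₀ˣ A h`, the slope `w'` of the solution of
`-ρ c² (1/A) (A w')' = h`, `w'(0) = 0`. -/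
def slopeInv : L2 W.ℓ →L[ℂ] L2 W.ℓ :=
  W.mulInv.comp ((volterra W.ℓ_pos).comp
    ((-(W.ρ * W.c ^ 2 : ℂ)⁻¹) • ⟨mulOp (fun x => (W.A x : ℂ)) W.continuousOn_area,
      continuous_mulOp _ _⟩))

/-- The inverse of `-A`, where `A = L|ker G`. -/
def negInv : W.State →L[ℂ] W.State :=
  (WithLp.prodContinuousLinearEquiv 2 ℂ (H1D W.ℓ) (L2 W.ℓ)).symm.toContinuousLinearMap.comp
    ((((primitiveD W.ℓ_pos).toContinuousLinearMap.comp W.slopeInv).comp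
      (WithLp.sndL 2 ℂ (H1D W.ℓ) (L2 W.ℓ))).prod
    ((-(W.ρ : ℂ)) • ((WithLp.fstL 2 ℂ (L2 W.ℓ) (L2 W.ℓ)).comp
      ((H1D W.ℓ).subtypeL.comp (WithLp.fstL 2 ℂ (H1D W.ℓ) (L2 W.ℓ))))))

theorem ρ_ne_zero : (W.ρ : ℂ) ≠ 0 := by exact_mod_cast W.ρ_pos.ne'

theorem c_ne_zero : (W.c : ℂ) ≠ 0 := by exact_mod_cast W.c_pos.ne'

theorem area_zero_ne_zero : (W.A 0 : ℂ) ≠ 0 := by exact_mod_cast (W.A_pos 0 W.zero_mem).ne'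

theorem fst_negInv (x : W.State) : (W.negInv x).fst = primitiveD W.ℓ_pos (W.slopeInv x.snd) := rfl

theorem slopeInv_apply (h : L2 W.ℓ) : W.slopeInv h = W.mulInv (volterra W.ℓ_pos
    ((-(W.ρ * W.c ^ 2 : ℂ)⁻¹) • mulOp (fun x => (W.A x : ℂ)) W.continuousOn_area h)) := rfl

theorem slopeInv_mem (h : L2 W.ℓ) : W.slopeInv h ∈ H1 W.ℓ := by
  obtain ⟨g', hg'⟩ := W.isACRep_mulInv (isACRep_volterra W.ℓ_pos
    ((-(W.ρ * W.c ^ 2 : ℂ)⁻¹) • mulOp (fun x => (W.A x : ℂ)) W.continuousOn_area h))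
  exact hg'.mem_H1

/-- `A w'` is an integral starting at `0`; this is the homogeneous input condition for `negInv`. -/
theorem eval_slopeInv (h : L2 W.ℓ) :
    H1.eval W.ℓ_pos 0 W.zero_mem ⟨W.slopeInv h, W.slopeInv_mem h⟩ = 0 := by
  have := W.eval_mulInv (isACRep_volterra W.ℓ_pos _) (W.slopeInv_mem h)
  rw [intervalIntegral.integral_same, mul_zero] at this
  exact this

theorem divArea_slopeInv (h : L2 W.ℓ) :
    W.divArea ⟨W.slopeInv h, W.slopeInv_mem h⟩ = (-(W.ρ * W.c ^ 2 : ℂ)⁻¹) • h := by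
  refine (W.divArea_mulInv (isACRep_volterra W.ℓ_pos _) (W.slopeInv_mem h)).trans ?_
  change W.mulInv ((-(W.ρ * W.c ^ 2 : ℂ)⁻¹) • mulOp _ W.continuousOn_area h) = _
  rw [map_smul, mulInv_mulOp_area]

/-- The vanishing of `f` at `0` passes to `A f`, and this is what allows integration from `0` to
recover `A f` from its derivative. -/
theorem slopeInv_divArea (f : H1 W.ℓ) (h0 : H1.eval W.ℓ_pos 0 W.zero_mem f = 0) :
    W.slopeInv (W.divArea f) = (-(W.ρ * W.c ^ 2 : ℂ)⁻¹) • (f : L2 W.ℓ) := by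
  have h1 : mulOp (fun x => (W.A x : ℂ)) W.continuousOn_area (W.divArea f)
      = H1.deriv W.ℓ_pos (W.mulArea f) := W.mulOp_area_mulInv _
  have h2 : H1.eval W.ℓ_pos 0 W.zero_mem (W.mulArea f) = 0 := by
    obtain ⟨g', hg'⟩ := W.isACRep_mulOp_area (H1.isACRep f)
    have h3 : H1.rep f 0 = 0 := h0
    refine (hg'.eval_eq W.ℓ_pos hg'.mem_H1 W.zero_mem).trans ?_
    rw [h3, mul_zero]
  rw [slopeInv_apply, map_smul, map_smul, h1, volterra_deriv W.ℓ_pos _ h2]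
  congr 1
  exact W.mulInv_mulOp_area f

/-- A pair with slope in `H¹` and momentum in `H¹_{ℓ}` belongs to the domain. -/
theorem mem_domain {z : W.State} (h1 : (z.fst : WithLp 2 (L2 W.ℓ × L2 W.ℓ)).snd ∈ H1 W.ℓ)
    {g : L2 W.ℓ} {u : ℝ → ℂ} (h2 : IsACRep z.snd g u) (hu : u W.ℓ = 0) : z ∈ W.domain :=
  ⟨h1, h2.mem_H1, (h2.eval_eq W.ℓ_pos h2.mem_H1 W.ℓ_mem).trans hu⟩

theorem isACRep_snd_negInv (x : W.State) :
    IsACRep (W.negInv x).snd ((-(W.ρ : ℂ)) • (x.fst : WithLp 2 (L2 W.ℓ × L2 W.ℓ)).snd)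
      ((-(W.ρ : ℂ)) • fun y => -integralL W.ℓ_pos (x.fst : WithLp 2 (L2 W.ℓ × L2 W.ℓ)).snd
        + ∫ t in 0..y, (x.fst : WithLp 2 (L2 W.ℓ × L2 W.ℓ)).snd t) :=
  (H1D.isACRep W.ℓ_pos x.fst).smul _

theorem slope_negInv_mem (x : W.State) :
    ((W.negInv x).fst : WithLp 2 (L2 W.ℓ × L2 W.ℓ)).snd ∈ H1 W.ℓ := by
  rw [fst_negInv, snd_primitiveD]
  exact W.slopeInv_mem _

theorem negInv_mem (x : W.State) : W.negInv x ∈ W.domain :=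
  W.mem_domain (W.slope_negInv_mem x) (W.isACRep_snd_negInv x) (by simp [integralL])

theorem slope_negInv (x : W.State) (h : W.negInv x ∈ W.domain) :
    W.slope ⟨W.negInv x, h⟩ = ⟨W.slopeInv x.snd, W.slopeInv_mem _⟩ :=
  Subtype.ext (snd_primitiveD W.ℓ_pos _)

theorem momentumD_negInv (x : W.State) (h : W.negInv x ∈ W.domain) :
    W.momentumD ⟨W.negInv x, h⟩ = (-(W.ρ : ℂ)) • x.fst := by
  refine Subtype.ext (WithLp.ofLp_injective 2 (Prod.ext rfl ?_))
  exact (W.isACRep_snd_negInv x).deriv_eq W.ℓ_pos h.2.1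

theorem isResolvent_negInv : W.node.IsResolvent 0 W.negInv where
  right_inv x := by
    refine ⟨W.negInv_mem x, ?_, ?_⟩
    · change -(W.A 0 : ℂ) • H1.eval W.ℓ_pos 0 W.zero_mem (W.slope ⟨W.negInv x, _⟩) = 0
      rw [slope_negInv, eval_slopeInv, smul_zero]
    · have e : W.node.L ⟨W.negInv x, W.negInv_mem x⟩ = -x := by
        refine WithLp.ofLp_injective 2 (Prod.ext ?_ ?_)
        · change (W.ρ⁻¹ : ℂ) • W.momentumD ⟨W.negInv x, _⟩ = -x.fst
          rw [momentumD_negInv, smul_smul, mul_neg, inv_mul_cancel₀ W.ρ_ne_zero, neg_one_smul]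
        · change (W.ρ * W.c ^ 2 : ℂ) • W.divArea (W.slope ⟨W.negInv x, _⟩) = -x.snd
          rw [slope_negInv, divArea_slopeInv, smul_smul, mul_neg, mul_inv_cancel₀, neg_one_smul]
          exact mul_ne_zero W.ρ_ne_zero (pow_ne_zero 2 W.c_ne_zero)
      rw [e, zero_smul, zero_sub, neg_neg]
  left_inv z hz := by
    have hz : -(W.A 0 : ℂ) • H1.eval W.ℓ_pos 0 W.zero_mem (W.slope z) = 0 := hz
    have h0 := (smul_eq_zero.mp hz).resolve_left (neg_ne_zero.mpr W.area_zero_ne_zero)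
    rw [zero_smul, zero_sub, map_neg, neg_eq_iff_eq_neg]
    refine WithLp.ofLp_injective 2 (Prod.ext ?_ ?_)
    · change primitiveD W.ℓ_pos (W.slopeInv ((W.ρ * W.c ^ 2 : ℂ) • W.divArea (W.slope z)))
        = -(z : W.State).fst
      rw [map_smul, slopeInv_divArea _ _ h0, smul_smul, mul_neg, mul_inv_cancel₀, neg_one_smul,
        map_neg]
      · exact congrArg Neg.neg (primitiveD_snd W.ℓ_pos _)
      · exact mul_ne_zero W.ρ_ne_zero (pow_ne_zero 2 W.c_ne_zero)
    · change (-(W.ρ : ℂ)) • (W.ρ⁻¹ : ℂ) • (z : W.State).snd = -(z : W.State).snd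
      rw [smul_smul, neg_mul, mul_inv_cancel₀ W.ρ_ne_zero, neg_one_smul]

/-- The first component's norm sees the slope only in `L²`, where `H10` is dense; `primitiveD`
carries this density to `H1D`. Slopes in `H10` satisfy `G = 0`, and momenta in `H10` satisfy the
condition at `ℓ`. -/
theorem dense_ker : Dense {x : W.State | ∃ h : x ∈ W.node.dom, W.node.G ⟨x, h⟩ = 0} := by
  have h1 : Dense (primitiveD W.ℓ_pos '' (H10 W.ℓ : Set (L2 W.ℓ))) :=
    (primitiveD W.ℓ_pos).surjective.denseRange.dense_image (primitiveD W.ℓ_pos).continuous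
      (dense_H10 W.ℓ)
  let e := (WithLp.prodContinuousLinearEquiv 2 ℂ (H1D W.ℓ) (L2 W.ℓ)).symm
  refine (e.surjective.denseRange.dense_image e.continuous (h1.prod (dense_H10 W.ℓ))).mono ?_
  rintro _ ⟨⟨_, f⟩, ⟨⟨g, ⟨g', u, hu, hu0, -⟩, rfl⟩, ⟨f', v, hv, -, hv1⟩⟩, rfl⟩
  have hg : (primitiveD W.ℓ_pos g : WithLp 2 (L2 W.ℓ × L2 W.ℓ)).snd = g := snd_primitiveD _ g
  have hm : (primitiveD W.ℓ_pos g : WithLp 2 (L2 W.ℓ × L2 W.ℓ)).snd ∈ H1 W.ℓ := by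
    rw [hg]
    exact hu.mem_H1
  have hz : e (primitiveD W.ℓ_pos g, f) ∈ W.domain := W.mem_domain hm hv hv1
  refine ⟨hz, ?_⟩
  have es : W.slope ⟨_, hz⟩ = ⟨g, hu.mem_H1⟩ := Subtype.ext hg
  change -(W.A 0 : ℂ) • H1.eval W.ℓ_pos 0 W.zero_mem (W.slope ⟨_, hz⟩) = 0
  rw [es, hu.eval_eq W.ℓ_pos hu.mem_H1 W.zero_mem, hu0, smul_zero]

/-! ### The stationary flow -/

/-- The stationary state with unit flow: `w₁(x) = ∫ₓ^ℓ 1/A`, `w₂ = 0`. -/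
def unitFlow : W.State :=
  WithLp.toLp 2 (primitiveD W.ℓ_pos (-W.mulInv (oneL2 W.ℓ)), 0)

theorem mulInv_one_mem : W.mulInv (oneL2 W.ℓ) ∈ H1 W.ℓ :=
  let ⟨_, h⟩ := W.isACRep_mulInv (isACRep_one W.ℓ)
  h.mem_H1

theorem unitFlow_mem : W.unitFlow ∈ W.domain := by
  refine W.mem_domain (z := W.unitFlow) ?_ IsACRep.zero rfl
  change (primitiveD W.ℓ_pos (-W.mulInv (oneL2 W.ℓ)) : WithLp 2 (L2 W.ℓ × L2 W.ℓ)).snd ∈ H1 W.ℓ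
  rw [snd_primitiveD]
  exact (H1 W.ℓ).neg_mem W.mulInv_one_mem

theorem slope_unitFlow : W.slope ⟨W.unitFlow, W.unitFlow_mem⟩
    = -⟨W.mulInv (oneL2 W.ℓ), W.mulInv_one_mem⟩ :=
  Subtype.ext (snd_primitiveD W.ℓ_pos _)

theorem G_unitFlow : W.node.G ⟨W.unitFlow, W.unitFlow_mem⟩ = 1 := by
  change -(W.A 0 : ℂ) • H1.eval W.ℓ_pos 0 W.zero_mem (W.slope ⟨W.unitFlow, W.unitFlow_mem⟩) = 1
  rw [slope_unitFlow, map_neg, W.eval_mulInv (isACRep_one W.ℓ)]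
  simp [W.area_zero_ne_zero]

theorem L_unitFlow : W.node.L ⟨W.unitFlow, W.unitFlow_mem⟩ = 0 := by
  refine WithLp.ofLp_injective 2 (Prod.ext ?_ ?_)
  · change (W.ρ⁻¹ : ℂ) • W.momentumD ⟨W.unitFlow, W.unitFlow_mem⟩ = 0
    have e : W.momentumD ⟨W.unitFlow, W.unitFlow_mem⟩ = 0 := by
      refine Subtype.ext (WithLp.ofLp_injective 2 (Prod.ext rfl ?_))
      exact map_zero (H1.deriv W.ℓ_pos)
    rw [e, smul_zero]
  · change (W.ρ * W.c ^ 2 : ℂ) • W.divArea (W.slope ⟨W.unitFlow, W.unitFlow_mem⟩) = 0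
    rw [slope_unitFlow, map_neg, W.divArea_mulInv (isACRep_one W.ℓ), map_zero, neg_zero, smul_zero]

theorem K_unitFlow : W.node.K ⟨W.unitFlow, W.unitFlow_mem⟩ = 0 :=
  map_zero (H1.eval W.ℓ_pos 0 W.zero_mem)

/-- The output `K (-A)⁻¹`: `(w₁, w₂) ↦ -ρ w₁(0)`. -/
def outputInv : W.State →L[ℂ] ℂ :=
  (W.ρ : ℂ) • ((integralL W.ℓ_pos).comp ((derivL W.ℓ).comp
    (WithLp.fstL 2 ℂ (H1D W.ℓ) (L2 W.ℓ))))

/-- The momentum of `negInv x` is `-ρ w₁`. Since `w₁(ℓ) = 0`, its value at `0` is `ρ ∫₀^ℓ w₁'`, a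
bounded functional of the state. -/
theorem K_negInv (x : W.State) (h : W.negInv x ∈ W.node.dom) :
    W.node.K ⟨W.negInv x, h⟩ = W.outputInv x := by
  refine ((W.isACRep_snd_negInv x).eval_eq W.ℓ_pos (W.isACRep_snd_negInv x).mem_H1
    W.zero_mem).trans ?_
  change (-(W.ρ : ℂ)) * (-integralL W.ℓ_pos (x.fst : WithLp 2 (L2 W.ℓ × L2 W.ℓ)).snd
    + ∫ t in 0..0, (x.fst : WithLp 2 (L2 W.ℓ × L2 W.ℓ)).snd t)
    = (W.ρ : ℂ) * integralL W.ℓ_pos (x.fst : WithLp 2 (L2 W.ℓ × L2 W.ℓ)).snd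
  rw [intervalIntegral.integral_same]
  ring

theorem outputInv_unitFlow : W.outputInv W.unitFlow = -(W.inertance : ℂ) := by
  change (W.ρ : ℂ) * integralL W.ℓ_pos
    (primitiveD W.ℓ_pos (-W.mulInv (oneL2 W.ℓ)) : WithLp 2 (L2 W.ℓ × L2 W.ℓ)).snd = _
  rw [snd_primitiveD, map_neg, inertance, Complex.ofReal_mul, mul_neg,
    ← intervalIntegral.integral_ofReal]
  congr 2
  refine intervalIntegral_congr ?_ W.ℓ_mem
  filter_upwards [coeFn_mulOp _ W.continuousOn_area_inv (oneL2 W.ℓ), (isACRep_one W.ℓ).ae_eq]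
    with x h1 h2
  refine h1.trans ?_
  rw [h2]
  push_cast
  ring

/-! ### Positivity of the inertance and the conclusions for the horn -/

theorem inertance_pos : 0 < W.inertance := by
  refine mul_pos W.ρ_pos (intervalIntegral.intervalIntegral_pos_of_pos_on ?_ ?_ W.ℓ_pos)
  · refine ContinuousOn.intervalIntegrable ?_
    rw [uIcc_of_le W.ℓ_pos.le]
    exact continuousOn_const.div W.continuousOn_A fun x hx => (W.A_pos x hx).ne'
  · exact fun x hx => one_div_pos.mpr (W.A_pos x (Ioo_subset_Icc_self hx))

theorem isBoundaryNode : W.node.IsBoundaryNode :=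
  W.isResolvent_negInv.isBoundaryNode W.G_unitFlow W.L_unitFlow W.K_negInv W.dense_ker

theorem zero_mem_resolventSet : (0 : ℂ) ∈ W.node.resolventSet := ⟨_, W.isResolvent_negInv⟩

theorem impedance_zero : W.impedance 0 = 0 := by
  have h := Colligation.transferFunction_G W.zero_mem_resolventSet
    ⟨W.unitFlow, W.unitFlow_mem⟩ (by rw [L_unitFlow, zero_smul])
  rwa [G_unitFlow, K_unitFlow] at h

theorem hasDerivAt_impedance : HasDerivAt W.impedance (W.inertance : ℂ) 0 := by
  have h := W.isResolvent_negInv.hasDerivAt_transferFunction W.L_unitFlow W.K_negInv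
  rwa [G_unitFlow, outputInv_unitFlow, neg_neg] at h

theorem hasInertialFactor_impedance : HasInertialFactor W.impedance W.inertance 1 := by
  have hC : (W.inertance : ℂ) ≠ 0 := by exact_mod_cast W.inertance_pos.ne'
  have h := (hasDerivAt_iff_tendsto_slope.mp W.hasDerivAt_impedance).div_const (W.inertance : ℂ)
  rw [div_self hC] at h
  rw [HasInertialFactor, Complex.ofReal_one]
  -- Since the impedance vanishes at `0`, `Z(s) / (C s)` is its difference quotient at `0` divided
  -- by `C`.
  refine h.congr fun s => ?_
  rw [slope_def_field, W.impedance_zero, sub_zero, sub_zero, div_div, mul_comm]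

end Horn

end Webster

end

theorem mainTheorem1 (W : Webster.Horn) :
    W.node.IsBoundaryNode ∧ (0 : ℂ) ∈ W.node.resolventSet ∧
      W.impedance 0 = 0 ∧
      HasDerivAt W.impedance (W.inertance : ℂ) 0 ∧
      Webster.InertiallyFeasible W.impedance W.inertance ∧
      Webster.HasInertialFactor W.impedance W.inertance 1 :=
  ⟨W.isBoundaryNode, W.zero_mem_resolventSet, W.impedance_zero, W.hasDerivAt_impedance,
    ⟨1, W.hasInertialFactor_impedance⟩, W.hasInertialFactor_impedance⟩
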